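/- Let $n\ge 2$, $\alpha=(\alpha_0,\dots,\alpha_{n-1})\in\mathbb R^n\setminus\{0\}$, and write $|x|=\max_i|x_i|$ for $x\in\mathbb R^n$. Fix an index $j$ with $|\alpha_j|=|\alpha|$ (after permuting the coordinates one may take $j=0$). Call a subspace of $\mathbb R^n$ rational if it has a basis of vectors in $\mathbb Q^n$, let $F$ be the smallest rational subspace of $\mathbb R^n$ containing $\alpha$, and let $d=\dim F$. For real $Q\ge 1$, let $\Psi_d(Q)$ be the infimum of the set of all $K>0$ such that there exist $d$ linearly independent vectors $x\in\mathbb Z^n\cap F$ with $$|x|\le K,\qquad |x_j\alpha-\alpha_j x|\le Q^{-1}.$$ Let $C'_1$ be the least integer $N\ge 1$ for which there is a non-zero $x\in\mathbb Z^n\cap F$ with $|x|\le N$. For real $Q\ge C'_1$, let $\Psi'_1(Q)$ be the supremum of the set of all $K>0$ such that there exists a non-zero $x\in\mathbb Z^n\cap F$ with $$|x|\le Q,\qquad |x\cdot\alpha|\le K^{-1}.$$ These quantities are well defined: the integer $C'_1$ exists, the set defining $\Psi_d(Q)$ is non-empty for every $Q\ge1$, and the set defining $\Psi'_1(Q)$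 is non-empty and bounded above for every $Q\ge C'_1$. Let $\tau\ge d-1$ be a real number. The vector $\alpha$ is called Diophantine with exponent $\tau$ if there are constants $Q'_\alpha\ge C'_1$ and $C'_\alpha>0$ such that $\Psi'_1(Q)\le C'_\alpha Q^\tau$ for all $Q\ge Q'_\alpha$. Then $\alpha$ is Diophantine with exponent $\tau$ if and only if there are constants $Q_\alpha\ge 1$ and $C_\alpha>0$ such that $\Psi_d(Q)\le C_\alpha Q^\tau$ for all $Q\ge Q_\alpha$. -/

import Mathlib

namespace Dio

/-- The real vector with the given integer coordinates. Real vectors are functions `Fin n → ℝ`,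
whose norm is the maximum norm. -/
def toReal {n : ℕ} (x : Fin n → ℤ) : Fin n → ℝ := fun i => (x i : ℝ)

/-- A subspace of `ℝⁿ` is rational if it has a basis consisting of vectors of `ℚⁿ`. -/
def IsRational {n : ℕ} (W : Submodule ℝ (Fin n → ℝ)) : Prop :=
  ∃ s : Set (Fin n → ℝ), (∀ v ∈ s, ∀ i, ∃ q : ℚ, v i = (q : ℝ)) ∧
    LinearIndepOn ℝ id s ∧ Submodule.span ℝ s = W

/-- The smallest rational subspace containing `α`, as the intersection of all of them. -/
def rationalHull {n : ℕ} (α : Fin n → ℝ) : Submodule ℝ (Fin n → ℝ) :=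
  sInf {W | IsRational W ∧ α ∈ W}

/-- The number `d` of effective frequencies of `α`. -/
noncomputable def numFreq {n : ℕ} (α : Fin n → ℝ) : ℕ :=
  Module.finrank ℝ (rationalHull α)

/-- There are `k` linearly independent integer vectors in the rational hull of `α`, all of which
satisfy `P`. -/
def HasIndep {n : ℕ} (α : Fin n → ℝ) (k : ℕ) (P : (Fin n → ℤ) → Prop) : Prop :=
  ∃ x : Fin k → (Fin n → ℤ), LinearIndependent ℝ (fun p => toReal (x p)) ∧
    ∀ p, toReal (x p) ∈ rationalHull α ∧ P (x p)

/-- The set of `K > 0` whose infimum is `Ψ_k(Q)`; `j` is the reference coordinate, the one at which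
`|α|` is attained. -/
def psiSet {n : ℕ} (α : Fin n → ℝ) (j : Fin n) (k : ℕ) (Q : ℝ) : Set ℝ :=
  {K | 0 < K ∧ HasIndep α k fun x =>
    ‖toReal x‖ ≤ K ∧ ‖(x j : ℝ) • α - α j • toReal x‖ ≤ Q⁻¹}

/-- `Ψ_k(Q)`. -/
noncomputable def psi {n : ℕ} (α : Fin n → ℝ) (j : Fin n) (k : ℕ) (Q : ℝ) : ℝ :=
  sInf (psiSet α j k Q)

/-- `C'_k`: the least integer `Q ≥ 1` for which there are `k` linearly independent integer vectors
of norm at most `Q` in the rational hull of `α`. -/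
noncomputable def cPrime {n : ℕ} (α : Fin n → ℝ) (k : ℕ) : ℕ :=
  sInf {Q : ℕ | 1 ≤ Q ∧ HasIndep α k fun x => ‖toReal x‖ ≤ (Q : ℝ)}

/-- The set of `K > 0` whose supremum is `Ψ'_k(Q)`, for `Q ≥ C'_k`. -/
def psiPrimeSet {n : ℕ} (α : Fin n → ℝ) (k : ℕ) (Q : ℝ) : Set ℝ :=
  {K | 0 < K ∧ HasIndep α k fun x => ‖toReal x‖ ≤ Q ∧ |toReal x ⬝ᵥ α| ≤ K⁻¹}

/-- `Ψ'_k(Q)`. -/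
noncomputable def psiPrime {n : ℕ} (α : Fin n → ℝ) (k : ℕ) (Q : ℝ) : ℝ :=
  sSup (psiPrimeSet α k Q)

/-- `α` is Diophantine with exponent `τ`. -/
def IsDiophantine {n : ℕ} (α : Fin n → ℝ) (τ : ℝ) : Prop :=
  ∃ Q' C' : ℝ, (cPrime α 1 : ℝ) ≤ Q' ∧ 0 < C' ∧ ∀ Q : ℝ, Q' ≤ Q → psiPrime α 1 Q ≤ C' * Q ^ τ

end Dio

/-!
The theorem is a transference principle between two families of convex bodies that are polar to
each other, taken with respect to the lattice `Λ` of integer vectors in the rational hull `F` of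
`α`: up to constants, `Ψ_d(Q)` and `Ψ'_1(Q)` are the same function of `Q`, after rescaling `Q` by a
constant. Such a rescaling changes `Q ^ τ` only by a constant factor.

The bound `Ψ'_1(κ Q) ≤ (2 / |α|) Ψ_d(Q)`, with `κ = |α| / (2n)`, is the easy half
(`le_of_mem_psiSet_of_mem_psiPrimeSet`). If `d` independent vectors `x` approximate the line of `α`
and `y ∈ Λ` is nonzero, then some `x ⬝ᵥ y` is a nonzero integer, and splitting `x` along `α` bounds
it by `|y ⬝ᵥ α|` plus a small error.

The other half (`exists_hasIndep_of_lower_bound`) needs the geometry of numbers. For a lattice `L`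
of rank `d` in a Euclidean space whose nonzero dual vectors all have length at least `r`, the
lattice vectors of length at most `C_d / r` span the space (`exists_span_short_vectors_eq_top`).
Minkowski's first theorem for `L` and for its dual, whose covolumes are reciprocal, produces a
nonzero `v ∈ L` of length at most `γ_d / r`; then one projects to `vᗮ` and uses induction on `d`,
lifting the vectors found there so that their component along `v` is at most `‖v‖`. This avoids
Minkowski's second theorem. The result is applied to the image of `Λ` under the map that divides by
`K` along `α` and multiplies by `Q` orthogonally to it (`exists_span_dilation_eq_top`). The dual of
`Λ` in `F` is not `Λ`, but a fixed integer multiple of it lies in `Λ`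
(`exists_smul_dual_integer`).

Both the well-definedness of the approximation functions and the positivity of `|z ⬝ᵥ α|` for
nonzero `z ∈ Λ` rest on the description of `F` as the span of the vectors obtained by applying the
`ℚ`-linear forms `ℝ → ℚ` to the coordinates of `α` (`rationalHull_eq_span`). It shows that `F` is
spanned by integer vectors and that an integer relation satisfied by `α` holds on all of `F`.
-/

namespace Dio

open MeasureTheory Module Submodule

/-! ### A transference inequality for Euclidean lattices -/

/-- Dual bases span lattices of reciprocal covolumes. -/
theorem covolume_mul_covolume_dual {E : Type*} [NormedAddCommGroup E] [InnerProductSpace ℝ E]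
    [FiniteDimensional ℝ E] [MeasurableSpace E] [BorelSpace E] {ι : Type*} [Fintype ι]
    [DecidableEq ι] (b c : Basis ι ℝ E)
    (h : ∀ i j, inner ℝ (b i) (c j) = if i = j then (1 : ℝ) else 0) :
    volume.real (ZSpan.fundamentalDomain b) * volume.real (ZSpan.fundamentalDomain c) = 1 := by
  have hcard : finrank ℝ E = Fintype.card ι := finrank_eq_card_basis b
  let o : OrthonormalBasis ι ℝ E :=
    (stdOrthonormalBasis ℝ E).reindex (Fintype.equivOfCardEq (by simp [hcard]))
  have hvol : volume.real (ZSpan.fundamentalDomain o.toBasis) = 1 := by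
    have h1 : volume (ZSpan.fundamentalDomain o.toBasis) = volume (parallelepiped o.toBasis) :=
      measure_congr (ZSpan.fundamentalDomain_ae_parallelepiped _ _)
    rw [measureReal_def, h1, o.coe_toBasis, o.volume_parallelepiped, ENNReal.toReal_one]
  have hmat : (o.toBasis.toMatrix b).transpose * o.toBasis.toMatrix c = 1 := by
    ext i k
    rw [Matrix.mul_apply, Matrix.one_apply, ← h i k, ← o.sum_inner_mul_inner]
    refine Finset.sum_congr rfl fun l _ => ?_
    simp [Basis.toMatrix_apply, o.repr_apply_apply, real_inner_comm]
  have hdet : o.toBasis.det b * o.toBasis.det c = 1 := by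
    have := congrArg Matrix.det hmat
    rwa [Matrix.det_mul, Matrix.det_transpose, Matrix.det_one] at this
  rw [ZSpan.measureReal_fundamentalDomain b volume o.toBasis,
    ZSpan.measureReal_fundamentalDomain c volume o.toBasis, hvol, mul_one, mul_one, ← abs_mul, hdet,
    abs_one]

/-- Minkowski's first theorem for balls. -/
theorem exists_mem_span_norm_lt {E : Type*} [NormedAddCommGroup E] [InnerProductSpace ℝ E]
    [FiniteDimensional ℝ E] [MeasurableSpace E] [BorelSpace E] {ι : Type*} [Fintype ι]
    (b : Basis ι ℝ E) {R : ℝ} (hR : 0 < R)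
    (h : volume.real (ZSpan.fundamentalDomain b) * 2 ^ finrank ℝ E <
      R ^ finrank ℝ E * volume.real (Metric.ball (0 : E) 1)) :
    ∃ v ∈ span ℤ (Set.range b), v ≠ 0 ∧ ‖v‖ < R := by
  have hfund := ZSpan.isAddFundamentalDomain' b volume
  have hfin : volume (ZSpan.fundamentalDomain b) ≠ ⊤ :=
    (ZSpan.fundamentalDomain_isBounded b).measure_lt_top.ne
  have hball : volume (Metric.ball (0 : E) 1) ≠ ⊤ := Metric.isBounded_ball.measure_lt_top.ne
  have : Countable (span ℤ (Set.range b)).toAddSubgroup :=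
    inferInstanceAs (Countable (span ℤ (Set.range b)))
  obtain ⟨x, hx0, hx⟩ := exists_ne_zero_mem_lattice_of_measure_mul_two_pow_lt_measure
    (s := Metric.ball (0 : E) R) hfund (by simp) (convex_ball _ _) (by
      rw [Measure.addHaar_ball_of_pos _ _ hR, ← ENNReal.toReal_lt_toReal
        (ENNReal.mul_ne_top hfin (by simp)) (ENNReal.mul_ne_top (by simp) hball),
        ENNReal.toReal_mul, ENNReal.toReal_mul, ENNReal.toReal_ofReal (by positivity)]
      simpa [measureReal_def] using h)
  exact ⟨x, x.2, fun h0 => hx0 (Subtype.ext h0), by simpa using hx⟩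

theorem discreteTopology_of_finite_ball {E : Type*} [NormedAddCommGroup E] (L : Submodule ℤ E)
    (h : {x | x ∈ L ∧ ‖x‖ ≤ 1}.Finite) : DiscreteTopology L := by
  apply discreteTopology_of_isOpen_singleton_zero
  have hS : {x : L | ‖(x : E)‖ ≤ 1 ∧ x ≠ 0}.Finite :=
    Set.Finite.of_finite_image (h.subset (by rintro _ ⟨x, hx, rfl⟩; exact ⟨x.2, hx.1⟩))
      Subtype.val_injective.injOn
  have : ({0} : Set L) = Metric.ball 0 1 ∩ {x : L | ‖(x : E)‖ ≤ 1 ∧ x ≠ 0}ᶜ := by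
    ext x
    simp only [Set.mem_singleton_iff, Set.mem_inter_iff, mem_ball_zero_iff, Set.mem_compl_iff,
      Set.mem_ofPred_eq, not_and, not_not, Submodule.coe_norm]
    exact ⟨fun hx => by simp [hx], fun hx => hx.2 hx.1.le⟩
  rw [this]
  exact Metric.isOpen_ball.inter hS.isClosed.isOpen_compl

theorem exists_int_inner_eq_of_span {E : Type*} [NormedAddCommGroup E] [InnerProductSpace ℝ E]
    {ι κ : Type*} {b : ι → E} {c : κ → E} (h : ∀ i k, ∃ m : ℤ, inner ℝ (b i) (c k) = (m : ℝ))
    {x y : E} (hx : x ∈ span ℤ (Set.range b)) (hy : y ∈ span ℤ (Set.range c)) :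
    ∃ m : ℤ, inner ℝ x y = (m : ℝ) := by
  induction hx, hy using span_induction₂ with
  | mem_mem x y hx hy =>
    obtain ⟨i, rfl⟩ := hx
    obtain ⟨k, rfl⟩ := hy
    exact h i k
  | zero_left y hy => exact ⟨0, by simp⟩
  | zero_right x hx => exact ⟨0, by simp⟩
  | add_left x y z _ _ _ hx hy =>
    obtain ⟨p, hp⟩ := hx
    obtain ⟨q, hq⟩ := hy
    exact ⟨p + q, by rw [inner_add_left, hp, hq, Int.cast_add]⟩
  | add_right x y z _ _ _ hx hy =>
    obtain ⟨p, hp⟩ := hx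
    obtain ⟨q, hq⟩ := hy
    exact ⟨p + q, by rw [inner_add_right, hp, hq, Int.cast_add]⟩
  | smul_left a x y _ _ hx =>
    obtain ⟨p, hp⟩ := hx
    exact ⟨a * p, by rw [← Int.cast_smul_eq_zsmul ℝ, real_inner_smul_left, hp, Int.cast_mul]⟩
  | smul_right a x y _ _ hx =>
    obtain ⟨p, hp⟩ := hx
    exact ⟨a * p, by rw [← Int.cast_smul_eq_zsmul ℝ, real_inner_smul_right, hp, Int.cast_mul]⟩

/-- Minkowski's theorem for a lattice and its dual: their shortest vectors have lengths whose
product is bounded in terms of the dimension. -/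
theorem exists_short_vector_of_dual (d : ℕ) (hd : 0 < d) : ∃ γ : ℝ, 0 < γ ∧
    ∀ (E : Type) [NormedAddCommGroup E] [InnerProductSpace ℝ E] [FiniteDimensional ℝ E],
      finrank ℝ E = d → ∀ L : Submodule ℤ E, (∀ R : ℝ, {x | x ∈ L ∧ ‖x‖ ≤ R}.Finite) →
      span ℝ (L : Set E) = ⊤ → ∀ r : ℝ, 0 < r →
      (∀ y : E, (∀ x ∈ L, ∃ m : ℤ, inner ℝ x y = (m : ℝ)) → y ≠ 0 → r ≤ ‖y‖) →
      ∃ v ∈ L, v ≠ 0 ∧ ‖v‖ ≤ γ / r := by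
  -- `V` is the volume of the unit ball in dimension `d`.
  set V : ℝ := √Real.pi ^ d / Real.Gamma (d / 2 + 1) with hVdef
  have hV : 0 < V := by
    have : 0 < Real.Gamma ((d : ℝ) / 2 + 1) := Real.Gamma_pos_of_pos (by positivity)
    have := Real.pi_pos
    positivity
  refine ⟨4 * (1 + (V ^ 2)⁻¹), by positivity, ?_⟩
  intro E _ _ _ hE L hfin hspan r hr hdual
  let : MeasurableSpace E := borel E
  have : BorelSpace E := ⟨rfl⟩
  have hnt : Nontrivial E := Module.nontrivial_of_finrank_pos (R := ℝ) (hE ▸ hd)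
  have hvol : volume.real (Metric.ball (0 : E) 1) = V := by
    rw [measureReal_def, InnerProductSpace.volume_ball, hE]
    simp only [ENNReal.ofReal_one, one_pow, one_mul]
    exact ENNReal.toReal_ofReal hV.le
  have := discreteTopology_of_finite_ball L (hfin 1)
  have : IsZLattice ℝ L := ⟨hspan⟩
  classical
  let b := (Free.chooseBasis ℤ L).ofZLatticeBasis ℝ L
  have hbL : span ℤ (Set.range b) = L := (Free.chooseBasis ℤ L).ofZLatticeBasis_span ℝ L
  have hnd : (innerₗ E : LinearMap.BilinForm ℝ E).Nondegenerate := by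
    constructor
    · intro x hx
      simpa using hx x
    · intro x hx
      simpa using hx x
  let c := LinearMap.BilinForm.dualBasis _ hnd b
  have hbc : ∀ i k, inner ℝ (b i) (c k) = if i = k then (1 : ℝ) else 0 := by
    intro i k
    have := LinearMap.BilinForm.apply_dualBasis_left hnd b k i
    rwa [innerₗ_apply_apply, real_inner_comm] at this
  have hprod := covolume_mul_covolume_dual b c hbc
  set A := volume.real (ZSpan.fundamentalDomain b)
  set B := volume.real (ZSpan.fundamentalDomain c)
  have hA : 0 ≤ A := measureReal_nonneg
  have hB : 0 ≤ B := measureReal_nonneg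
  have hB' : 0 < B := lt_of_le_of_ne hB fun h => by simp [← h] at hprod
  have h1 : r ^ d * V ≤ B * 2 ^ d := by
    by_contra! hlt
    obtain ⟨w, hw, hw0, hwr⟩ := exists_mem_span_norm_lt c hr (by rwa [hE, hvol])
    refine absurd (hdual w ?_ hw0) (not_le.mpr hwr)
    refine fun x hx => exists_int_inner_eq_of_span (fun i k => ⟨if i = k then 1 else 0, ?_⟩)
      (hbL.symm ▸ hx) hw
    rw [hbc]
    split_ifs <;> simp
  have h2 : A * 2 ^ d < (4 * (1 + (V ^ 2)⁻¹) / r) ^ d * V := by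
    have hone : (V ^ 2)⁻¹ < (1 + (V ^ 2)⁻¹) ^ d := by
      have : (1 + (V ^ 2)⁻¹) ≤ (1 + (V ^ 2)⁻¹) ^ d :=
        le_self_pow₀ (by have : 0 < (V ^ 2)⁻¹ := by positivity
                         linarith) hd.ne'
      linarith
    have hrd : 0 < r ^ d := by positivity
    rw [div_pow, div_mul_eq_mul_div, lt_div_iff₀ hrd, mul_pow]
    have e1 : A * (r ^ d * V) ≤ 2 ^ d := by
      calc A * (r ^ d * V) ≤ A * (B * 2 ^ d) := by gcongr
        _ = 2 ^ d := by rw [← mul_assoc, hprod, one_mul]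
    have e2 : (2 : ℝ) ^ d * 2 ^ d = 4 ^ d := by rw [← mul_pow]; norm_num
    have e3 : 1 < (1 + (V ^ 2)⁻¹) ^ d * V ^ 2 := by
      have := mul_lt_mul_of_pos_right hone (pow_pos hV 2)
      rwa [inv_mul_cancel₀ (by positivity)] at this
    refine lt_of_mul_lt_mul_right ?_ hV.le
    calc A * 2 ^ d * r ^ d * V = A * (r ^ d * V) * 2 ^ d := by ring
      _ ≤ 2 ^ d * 2 ^ d := by gcongr
      _ = 4 ^ d * 1 := by rw [e2, mul_one]
      _ < 4 ^ d * ((1 + (V ^ 2)⁻¹) ^ d * V ^ 2) := by gcongr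
      _ = _ := by ring
  obtain ⟨v, hv, hv0, hvr⟩ := exists_mem_span_norm_lt b (R := 4 * (1 + (V ^ 2)⁻¹) / r)
    (by positivity) (by rwa [hE, hvol])
  exact ⟨v, hbL ▸ hv, hv0, hvr.le⟩

/-- The lattice vectors of length at most `C / r` span, if no nonzero dual vector is shorter than
`r`. The induction splits off a shortest vector `v`: the dual of the projection of the lattice to
`vᗮ` is contained in the dual of the lattice. -/
theorem exists_span_short_vectors_eq_top (d : ℕ) : ∃ C : ℝ, 0 < C ∧
    ∀ (E : Type) [NormedAddCommGroup E] [InnerProductSpace ℝ E] [FiniteDimensional ℝ E],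
      finrank ℝ E = d → ∀ L : Submodule ℤ E, (∀ R : ℝ, {x | x ∈ L ∧ ‖x‖ ≤ R}.Finite) →
      span ℝ (L : Set E) = ⊤ → ∀ r : ℝ, 0 < r →
      (∀ y : E, (∀ x ∈ L, ∃ m : ℤ, inner ℝ x y = (m : ℝ)) → y ≠ 0 → r ≤ ‖y‖) →
      span ℝ {x | x ∈ L ∧ ‖x‖ ≤ C / r} = ⊤ := by
  induction d with
  | zero =>
    refine ⟨1, one_pos, ?_⟩
    intro E _ _ _ hE L _ _ r _ _
    have : Subsingleton E := finrank_zero_iff.mp hE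
    exact Subsingleton.elim _ _
  | succ d ih =>
    obtain ⟨C, hC, ih⟩ := ih
    obtain ⟨γ, hγ, hshort⟩ := exists_short_vector_of_dual (d + 1) d.succ_pos
    refine ⟨C + γ, by positivity, ?_⟩
    intro E _ _ _ hE L hfin hspan r hr hdual
    obtain ⟨v, hvL, hv0, hv⟩ := hshort E hE L hfin hspan r hr hdual
    have hE' : Fact (finrank ℝ E = d + 1) := ⟨hE⟩
    set K : Submodule ℝ E := (ℝ ∙ v)ᗮ with hK
    have hKd : finrank ℝ K = d := finrank_orthogonal_span_singleton hv0
    have hproj : ∀ x : E, ((K.orthogonalProjectionOnto x : K) : E) =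
        x - (inner ℝ v x / ‖v‖ ^ 2) • v := by
      intro x
      have := starProjection_orthogonal_val (K := ℝ ∙ v) x
      rw [starProjection_singleton] at this
      exact this
    have hpv : K.orthogonalProjectionOnto v = 0 := by
      ext
      have : ‖v‖ ^ 2 ≠ 0 := by positivity
      rw [hproj, real_inner_self_eq_norm_sq, div_self this]
      simp
    -- Subtracting a multiple of `v` makes the component along `v` at most `‖v‖`.
    have hred : ∀ x ∈ L, ∃ x' ∈ L, K.orthogonalProjectionOnto x' = K.orthogonalProjectionOnto x ∧
        ‖x'‖ ≤ ‖K.orthogonalProjectionOnto x‖ + ‖v‖ := by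
      intro x hx
      set t := inner ℝ v x / ‖v‖ ^ 2 with ht
      refine ⟨x - ⌊t⌋ • v, L.sub_mem hx (L.smul_mem _ hvL), ?_, ?_⟩
      · rw [map_sub, ← Int.cast_smul_eq_zsmul ℝ, map_smul, hpv]
        simp
      · have : x - ⌊t⌋ • v = (K.orthogonalProjectionOnto x : E) + Int.fract t • v := by
          rw [hproj, ← Int.cast_smul_eq_zsmul ℝ, Int.fract, sub_smul]
          abel
        rw [this]
        refine (norm_add_le _ _).trans (add_le_add le_rfl ?_)
        rw [norm_smul, Real.norm_eq_abs, Int.abs_fract]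
        exact mul_le_of_le_one_left (norm_nonneg _) (Int.fract_lt_one t).le
    let L' : Submodule ℤ K :=
      L.map (K.orthogonalProjectionOnto.toLinearMap.restrictScalars ℤ)
    have hmem : ∀ z, z ∈ L' ↔ ∃ x ∈ L, K.orthogonalProjectionOnto x = z := fun z => by
      simp [L', Submodule.mem_map]
    have hfin' : ∀ R : ℝ, {x | x ∈ L' ∧ ‖x‖ ≤ R}.Finite := by
      intro R
      refine ((hfin (R + ‖v‖)).image K.orthogonalProjectionOnto).subset ?_
      rintro z ⟨hz, hzR⟩
      obtain ⟨x, hx, rfl⟩ := (hmem z).mp hz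
      obtain ⟨x', hx', he, hle⟩ := hred x hx
      exact ⟨x', ⟨hx', hle.trans (by gcongr)⟩, he⟩
    have hspan' : span ℝ (L' : Set K) = ⊤ := by
      have h1 : (L' : Set K) = K.orthogonalProjectionOnto.toLinearMap '' (L : Set E) := by
        ext z
        simp [hmem]
      rw [h1, span_image, hspan, Submodule.map_top, LinearMap.range_eq_top]
      exact fun z => ⟨z, by simp⟩
    have hdual' : ∀ y : K, (∀ x ∈ L', ∃ m : ℤ, inner ℝ x y = (m : ℝ)) → y ≠ 0 → r ≤ ‖y‖ := by
      intro y hy hy0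
      refine hdual y (fun x hx => ?_) (by simpa using hy0)
      obtain ⟨m, hm⟩ := hy _ ((hmem _).mpr ⟨x, hx, rfl⟩)
      exact ⟨m, by rw [← hm, inner_orthogonalProjectionOnto_eq_of_mem_right]⟩
    have hih := ih K hKd L' hfin' hspan' r hr hdual'
    set W := span ℝ {x | x ∈ L ∧ ‖x‖ ≤ (C + γ) / r} with hW
    have hvW : v ∈ W := subset_span ⟨hvL, hv.trans (by gcongr; linarith)⟩
    have hKW : ∀ z : K, (z : E) ∈ W := by
      have : span ℝ {x | x ∈ L' ∧ ‖x‖ ≤ C / r} ≤ W.comap K.subtype := by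
        rw [span_le]
        rintro z ⟨hz, hzC⟩
        obtain ⟨x, hx, rfl⟩ := (hmem z).mp hz
        obtain ⟨x', hx', he, hle⟩ := hred x hx
        have hx'W : x' ∈ W := by
          refine subset_span ⟨hx', hle.trans ?_⟩
          rw [add_div]
          exact add_le_add hzC hv
        simp only [SetLike.mem_coe, mem_comap, subtype_apply]
        rw [← he, hproj]
        exact W.sub_mem hx'W (W.smul_mem _ hvW)
      intro z
      exact this (hih ▸ mem_top)
    rw [eq_top_iff]
    intro x _
    have := W.add_mem (hKW (K.orthogonalProjectionOnto x))
      (W.smul_mem (inner ℝ v x / ‖v‖ ^ 2) hvW)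
    rwa [hproj, sub_add_cancel] at this

/-! ### The rational hull -/

/-- A `ℚ`-linear form on `ℝ`, applied to the coordinates, preserves rational subspaces. -/
theorem map_mem_of_isRational {n : ℕ} {W : Submodule ℝ (Fin n → ℝ)} (hW : IsRational W)
    {x : Fin n → ℝ} (hx : x ∈ W) (φ : ℝ →ₗ[ℚ] ℚ) : (fun i => (φ (x i) : ℝ)) ∈ W := by
  obtain ⟨s, hs, -, rfl⟩ := hW
  induction hx using span_induction generalizing φ with
  | mem w hw =>
    choose q hq using hs w hw
    have : (fun i => (φ (w i) : ℝ)) = (φ 1 : ℝ) • w := by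
      ext i
      have : (q i : ℝ) = q i • (1 : ℝ) := by rw [Rat.smul_def, mul_one]
      rw [Pi.smul_apply, hq i, this, map_smul, Rat.smul_def]
      simp [mul_comm]
    rw [this]
    exact smul_mem _ _ (subset_span hw)
  | zero => simp only [Pi.zero_apply, map_zero, Rat.cast_zero]; exact zero_mem (span ℝ s)
  | add x y _ _ hx hy =>
    have := add_mem (hx φ) (hy φ)
    convert this using 1
    ext i
    simp
  | smul c x _ hx =>
    exact hx (φ ∘ₗ LinearMap.mulLeft ℚ c)

theorem rationalHull_eq_span {n : ℕ} (α : Fin n → ℝ) :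
    rationalHull α =
      span ℝ {v | ∃ φ : ℝ →ₗ[ℚ] ℚ, v = fun i => (φ (α i) : ℝ)} := by
  set s := {v | ∃ φ : ℝ →ₗ[ℚ] ℚ, v = fun i => (φ (α i) : ℝ)} with hs
  apply le_antisymm
  · refine sInf_le ⟨?_, ?_⟩
    · obtain ⟨b, hb, hspan, hli⟩ := exists_linearIndependent ℝ s
      refine ⟨b, fun v hv i => ?_, hli, hspan⟩
      obtain ⟨φ, rfl⟩ := hb hv
      exact ⟨_, rfl⟩
    · -- Expand the coordinates of `α` in a basis of `ℝ` over `ℚ`.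
      classical
      let B := Basis.ofVectorSpace ℚ ℝ
      let S := Finset.univ.biUnion fun i => (B.repr (α i)).support
      have : α = ∑ k ∈ S, B k • fun i => (B.coord k (α i) : ℝ) := by
        ext i
        rw [Finset.sum_apply]
        conv_lhs => rw [← B.linearCombination_repr (α i), Finsupp.linearCombination_apply]
        rw [Finsupp.sum_of_support_subset (s := S) _ (Finset.subset_biUnion_of_mem
          (fun i => (B.repr (α i)).support) (Finset.mem_univ i)) _ (by simp)]
        refine Finset.sum_congr rfl fun k _ => ?_
        simp [Rat.smul_def, mul_comm]
      rw [this]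
      exact sum_mem fun k _ => smul_mem _ _ (subset_span ⟨B.coord k, rfl⟩)
  · refine le_sInf ?_
    rintro W ⟨hW, hα⟩
    rw [span_le]
    rintro _ ⟨φ, rfl⟩
    exact map_mem_of_isRational hW hα φ

theorem mem_rationalHull {n : ℕ} (α : Fin n → ℝ) : α ∈ rationalHull α :=
  Submodule.mem_sInf.mpr fun _ hW => hW.2

/-- The rational hull is spanned by its integer vectors. -/
theorem span_toReal_eq_rationalHull {n : ℕ} (α : Fin n → ℝ) :
    span ℝ {v | v ∈ rationalHull α ∧ ∃ x : Fin n → ℤ, v = toReal x} = rationalHull α := by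
  apply le_antisymm
  · exact span_le.mpr fun v hv => hv.1
  · conv_lhs => rw [rationalHull_eq_span]
    rw [span_le]
    rintro v ⟨φ, hφ⟩
    have hv : v ∈ rationalHull α := by
      rw [rationalHull_eq_span]
      exact subset_span ⟨φ, hφ⟩
    -- `D` is a common denominator of the coordinates of `v`.
    set D : ℕ := ∏ i, (φ (α i)).den with hD
    have hD0 : (D : ℝ) ≠ 0 := by
      rw [Nat.cast_ne_zero, hD, Finset.prod_ne_zero_iff]
      exact fun i _ => (φ (α i)).den_nz
    have hint : ∀ i, ∃ m : ℤ, (D : ℝ) * v i = m := by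
      intro i
      obtain ⟨e, he⟩ := Finset.dvd_prod_of_mem (fun i => (φ (α i)).den) (Finset.mem_univ i)
      refine ⟨(φ (α i)).num * e, ?_⟩
      have h2 : ((φ (α i) : ℚ) : ℝ) * ((φ (α i)).den : ℝ) = ((φ (α i)).num : ℝ) := by
        exact_mod_cast Rat.mul_den_eq_num (φ (α i))
      rw [hφ, hD, he]
      push_cast
      rw [← h2]
      ring
    choose x hx using hint
    have hvx : (D : ℝ) • v = toReal x := by
      ext i
      exact hx i
    have : v = (D : ℝ)⁻¹ • toReal x := by rw [← hvx, inv_smul_smul₀ hD0]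
    rw [this]
    exact smul_mem _ _ (subset_span ⟨hvx ▸ smul_mem _ _ hv, x, rfl⟩)

/-- An integer relation satisfied by `α` holds on the whole rational hull. -/
theorem dotProduct_eq_zero_of_mem_rationalHull {n : ℕ} {α : Fin n → ℝ} {x : Fin n → ℤ}
    (hx : toReal x ⬝ᵥ α = 0) {w : Fin n → ℝ} (hw : w ∈ rationalHull α) : toReal x ⬝ᵥ w = 0 := by
  rw [rationalHull_eq_span] at hw
  induction hw using span_induction with
  | zero => exact dotProduct_zero _
  | add x y _ _ hx hy => rw [dotProduct_add, hx, hy, add_zero]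
  | smul c x _ hx => rw [dotProduct_smul, hx, smul_zero]
  | mem w hw =>
    obtain ⟨φ, rfl⟩ := hw
    have h1 : φ (toReal x ⬝ᵥ α) = ∑ i, (x i : ℚ) * φ (α i) := by
      rw [dotProduct, map_sum]
      refine Finset.sum_congr rfl fun i _ => ?_
      have : toReal x i * α i = (x i : ℚ) • α i := by rw [Rat.smul_def]; simp [toReal]
      rw [this, map_smul, smul_eq_mul]
    rw [hx, map_zero] at h1
    have := congrArg (fun q : ℚ => (q : ℝ)) h1
    simpa [dotProduct, toReal] using this.symm

/-- A nonzero integer vector of the rational hull is not orthogonal to `α`. -/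
theorem dotProduct_ne_zero {n : ℕ} {α : Fin n → ℝ} {x : Fin n → ℤ}
    (hx : toReal x ∈ rationalHull α) (hx0 : toReal x ≠ 0) : toReal x ⬝ᵥ α ≠ 0 := fun h =>
  hx0 (dotProduct_self_eq_zero.mp (dotProduct_eq_zero_of_mem_rationalHull h hx))

theorem finite_toReal_norm_le {n : ℕ} (R : ℝ) : {x : Fin n → ℤ | ‖toReal x‖ ≤ R}.Finite := by
  refine (Set.finite_Icc (fun _ => -⌊R⌋ : Fin n → ℤ) (fun _ => ⌊R⌋)).subset ?_
  intro x hx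
  have h : ∀ i, |(x i : ℝ)| ≤ R := fun i => (norm_le_pi_norm (toReal x) i).trans hx
  refine ⟨fun i => ?_, fun i => Int.le_floor.mpr (abs_le.mp (h i)).2⟩
  have := (abs_le.mp (h i)).1
  exact neg_le.mp (Int.le_floor.mpr (by push_cast; linarith))

/-! ### Transference in the rational hull -/

theorem exists_fin_linearIndependent {V : Type*} [AddCommGroup V] [Module ℝ V]
    [FiniteDimensional ℝ V] {s : Set V} {W : Submodule ℝ V} (h : span ℝ s = W) :
    ∃ f : Fin (finrank ℝ W) → V, (∀ i, f i ∈ s) ∧ span ℝ (Set.range f) = W ∧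
      LinearIndependent ℝ f := by
  subst h
  exact exists_fun_fin_finrank_span_eq ℝ s

/-- A common denominator: a fixed multiple of the dual lattice of the integer vectors in the
rational hull consists of integer vectors. The determinant of a Gram matrix serves. -/
theorem exists_smul_dual_integer {n : ℕ} (α : Fin n → ℝ) : ∃ D : ℤ, D ≠ 0 ∧
    ∀ z ∈ rationalHull α,
      (∀ x : Fin n → ℤ, toReal x ∈ rationalHull α → ∃ m : ℤ, toReal x ⬝ᵥ z = (m : ℝ)) →
      ∃ y : Fin n → ℤ, (D : ℝ) • z = toReal y := by
  obtain ⟨f, hf, hspan, hli⟩ := exists_fin_linearIndependent (span_toReal_eq_rationalHull α)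
  choose hfα x hx using hf
  set G : Matrix _ _ ℤ := Matrix.of fun k l => x k ⬝ᵥ x l with hG
  have hGf : ∀ k l, ((G k l : ℤ) : ℝ) = f k ⬝ᵥ f l := by
    intro k l
    rw [hx, hx]
    simp [hG, dotProduct, toReal]
  have hGz : ∀ (c : _ → ℝ) k, (G.map (Int.cast : ℤ → ℝ)).mulVec c k =
      f k ⬝ᵥ ∑ l, c l • f l := by
    intro c k
    rw [dotProduct_sum, Matrix.mulVec, dotProduct]
    refine Finset.sum_congr rfl fun l _ => ?_
    rw [Matrix.map_apply, hGf, dotProduct_smul, smul_eq_mul, mul_comm]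
  refine ⟨G.det, fun hdet => ?_, ?_⟩
  · have hdet' : (G.map (Int.cast : ℤ → ℝ)).det = 0 := by
      have := (Int.castRingHom ℝ).map_det G
      rw [hdet, map_zero] at this
      exact this.symm
    obtain ⟨c, hc0, hc⟩ := Matrix.exists_mulVec_eq_zero_iff.mpr hdet'
    have h0 : ∑ l, c l • f l = 0 := by
      rw [← dotProduct_self_eq_zero]
      rw [sum_dotProduct]
      refine Finset.sum_eq_zero fun k _ => ?_
      rw [smul_dotProduct, ← hGz, hc, Pi.zero_apply, smul_zero]
    exact hc0 (funext (Fintype.linearIndependent_iff.mp hli c h0))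
  · intro z hz hint
    rw [← hspan, mem_span_range_iff_exists_fun] at hz
    obtain ⟨c, rfl⟩ := hz
    choose m hm using fun k => hint (x k) (hx k ▸ hfα k)
    have hGc : (G.map (Int.cast : ℤ → ℝ)).mulVec c = fun k => (m k : ℝ) := by
      ext k
      rw [hGz, ← hm k, ← hx k]
    have hadj : ∀ l, (G.det : ℝ) * c l = ((G.adjugate.mulVec m l : ℤ) : ℝ) := by
      intro l
      have h1 := congrArg (fun v => (G.adjugate.map (Int.cast : ℤ → ℝ)).mulVec v l) hGc
      have h2 : G.adjugate.map (Int.cast : ℤ → ℝ) * G.map (Int.cast : ℤ → ℝ) =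
          (G.det : ℝ) • (1 : Matrix _ _ ℝ) := by
        have h3 := congrArg (fun A : Matrix _ _ ℤ => A.map (Int.castRingHom ℝ)) G.adjugate_mul
        rw [Matrix.map_mul] at h3
        refine h3.trans ?_
        ext i k
        rw [Matrix.map_apply, Matrix.smul_apply, Matrix.smul_apply, Matrix.one_apply,
          Matrix.one_apply]
        split_ifs <;> simp
      simp only [Matrix.mulVec_mulVec, h2, Matrix.smul_mulVec, Matrix.one_mulVec, Pi.smul_apply,
        smul_eq_mul] at h1
      rw [h1]
      simp [Matrix.mulVec, dotProduct]
    refine ⟨fun i => ∑ l, G.adjugate.mulVec m l * x l i, ?_⟩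
    ext i
    simp only [Pi.smul_apply, Finset.sum_apply, smul_eq_mul, Finset.mul_sum, toReal, Int.cast_sum,
      Int.cast_mul]
    refine Finset.sum_congr rfl fun l _ => ?_
    rw [← mul_assoc, hadj, hx l]
    rfl

section Dilation

variable {E : Type} [NormedAddCommGroup E] [InnerProductSpace ℝ E]

/-- The linear map that multiplies by `q` along the line of `a` and by `p` orthogonally to it. -/
noncomputable def dilation (a : E) (p q : ℝ) : E →ₗ[ℝ] E :=
  p • LinearMap.id + ((q - p) / ‖a‖ ^ 2) • (innerₗ E a).smulRight a

theorem dilation_apply (a : E) (p q : ℝ) (w : E) :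
    dilation a p q w = p • w + ((q - p) / ‖a‖ ^ 2 * inner ℝ a w) • a := by
  simp [dilation, smul_smul]

theorem inner_dilation_left (a : E) (p q : ℝ) (v w : E) :
    inner ℝ (dilation a p q v) w = inner ℝ v (dilation a p q w) := by
  simp only [dilation_apply, inner_add_left, inner_add_right, real_inner_smul_left,
    real_inner_smul_right, real_inner_comm a v]
  ring

theorem inner_dilation_self {a : E} (ha : a ≠ 0) (p q : ℝ) (w : E) :
    inner ℝ a (dilation a p q w) = q * inner ℝ a w := by
  have : ‖a‖ ^ 2 ≠ 0 := by positivity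
  simp only [dilation_apply, inner_add_right, real_inner_smul_right, real_inner_self_eq_norm_sq]
  field_simp
  ring

theorem dilation_dilation_inv {a : E} (ha : a ≠ 0) {p q : ℝ} (hp : p ≠ 0) (hq : q ≠ 0) (w : E) :
    dilation a p⁻¹ q⁻¹ (dilation a p q w) = w := by
  rw [dilation_apply, inner_dilation_self ha, dilation_apply, smul_add, smul_smul,
    inv_mul_cancel₀ hp, one_smul, smul_smul, add_assoc, ← add_smul]
  have : p⁻¹ * ((q - p) / ‖a‖ ^ 2 * inner ℝ a w) +
      (q⁻¹ - p⁻¹) / ‖a‖ ^ 2 * (q * inner ℝ a w) = 0 := by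
    field_simp
    ring
  rw [this, zero_smul, add_zero]

theorem norm_dilation_le {a : E} (ha : a ≠ 0) (p q : ℝ) (w : E) :
    ‖dilation a p q w‖ ≤ (|p| + |q - p|) * ‖w‖ := by
  have ha' : 0 < ‖a‖ := norm_pos_iff.mpr ha
  rw [dilation_apply, add_mul]
  refine (norm_add_le _ _).trans ?_
  rw [norm_smul, norm_smul, Real.norm_eq_abs, Real.norm_eq_abs, abs_mul, abs_div, abs_pow, abs_norm]
  refine add_le_add le_rfl ?_
  calc |q - p| / ‖a‖ ^ 2 * |inner ℝ a w| * ‖a‖ ≤ |q - p| / ‖a‖ ^ 2 * (‖a‖ * ‖w‖) * ‖a‖ := by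
        gcongr
        exact abs_real_inner_le_norm a w
    _ = |q - p| * ‖w‖ := by field_simp

/-- Transference for a dilated lattice: if every nonzero lattice vector of length at most `Q` has
`|⟨a, z⟩| ≥ ‖a‖ / K`, then the lattice vectors lying, up to a constant, within `K` along `a` and
within `Q⁻¹` orthogonally to `a` span. Here `D` makes the dual lattice part of the lattice. -/
theorem exists_span_dilation_eq_top [FiniteDimensional ℝ E] {a : E} (ha : a ≠ 0)
    (L : Submodule ℤ E) (hfin : ∀ R : ℝ, {x | x ∈ L ∧ ‖x‖ ≤ R}.Finite)
    (hspan : span ℝ (L : Set E) = ⊤) {D : ℤ} (hD : D ≠ 0)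
    (hdual : ∀ y : E, (∀ x ∈ L, ∃ m : ℤ, inner ℝ x y = (m : ℝ)) → (D : ℝ) • y ∈ L) :
    ∃ C : ℝ, 0 < C ∧ ∀ Q K : ℝ, 0 < Q → 0 < K → 1 ≤ K * Q →
      (∀ z ∈ L, z ≠ 0 → ‖z‖ ≤ Q → ‖a‖ / K ≤ |inner ℝ a z|) →
      span ℝ {x | x ∈ L ∧ ∃ u : E, ‖u‖ ≤ C ∧ x = dilation a Q⁻¹ K u} = ⊤ := by
  obtain ⟨C, hC, htrans⟩ := exists_span_short_vectors_eq_top (finrank ℝ E)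
  have hD' : 0 < |(D : ℝ)| := abs_pos.mpr (Int.cast_ne_zero.mpr hD)
  have ha' : 0 < ‖a‖ := norm_pos_iff.mpr ha
  refine ⟨C / (1 / (2 * |(D : ℝ)|)), by positivity, ?_⟩
  intro Q K hQ hK hKQ hlow
  have hKinv : K⁻¹ ≤ Q := by rwa [inv_le_iff_one_le_mul₀' hK]
  set S := dilation a Q K⁻¹ with hS
  have hinv : ∀ w, dilation a Q⁻¹ K (S w) = w := fun w => by
    simpa using dilation_dilation_inv ha hQ.ne' (inv_ne_zero hK.ne') w
  have hinv' : ∀ w, S (dilation a Q⁻¹ K w) = w := fun w => by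
    simpa using dilation_dilation_inv ha (inv_ne_zero hQ.ne') hK.ne' w
  have hnorm : ∀ w, ‖S w‖ ≤ 2 * Q * ‖w‖ := fun w => by
    refine (norm_dilation_le ha _ _ w).trans ?_
    gcongr
    rw [abs_of_pos hQ, abs_of_nonpos (by linarith)]
    have : 0 < K⁻¹ := by positivity
    linarith
  let L' : Submodule ℤ E := L.map (S.restrictScalars ℤ)
  have hmem : ∀ z, z ∈ L' ↔ ∃ x ∈ L, S x = z := fun z => by simp [L', Submodule.mem_map]
  have key := htrans E rfl L' ?_ ?_ (1 / (2 * |(D : ℝ)|)) (by positivity) ?_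
  · set W := span ℝ {x | x ∈ L ∧ ∃ u : E, ‖u‖ ≤ C / (1 / (2 * |(D : ℝ)|)) ∧
      x = dilation a Q⁻¹ K u} with hW
    have hle : span ℝ {x | x ∈ L' ∧ ‖x‖ ≤ C / (1 / (2 * |(D : ℝ)|))} ≤
        W.comap (dilation a Q⁻¹ K) := by
      rw [span_le]
      rintro z ⟨hz, hzC⟩
      obtain ⟨x, hx, rfl⟩ := (hmem z).mp hz
      exact subset_span ⟨by rwa [hinv], S x, hzC, rfl⟩
    rw [eq_top_iff]
    intro x _
    have : S x ∈ W.comap (dilation a Q⁻¹ K) := hle (key ▸ mem_top)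
    rwa [mem_comap, hinv] at this
  · intro R
    refine ((hfin ((|Q⁻¹| + |K - Q⁻¹|) * R)).image S).subset ?_
    rintro z ⟨hz, hzR⟩
    obtain ⟨x, hx, rfl⟩ := (hmem z).mp hz
    refine ⟨x, ⟨hx, ?_⟩, rfl⟩
    have := norm_dilation_le ha Q⁻¹ K (S x)
    rw [hinv] at this
    exact this.trans (by gcongr)
  · have h1 : (L' : Set E) = S '' (L : Set E) := by
      ext z
      simp [hmem]
    rw [h1, span_image, hspan, Submodule.map_top, LinearMap.range_eq_top]
    exact fun z => ⟨_, hinv' z⟩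
  · intro y hy hy0
    -- A dual vector `y` shorter than `1 / (2|D|)` would make `D • S y` violate the lower bound.
    by_contra! hlt
    rw [lt_div_iff₀ (by positivity)] at hlt
    have hz : (D : ℝ) • S y ∈ L := by
      refine hdual _ fun x hx => ?_
      obtain ⟨m, hm⟩ := hy (S x) ((hmem _).mpr ⟨x, hx, rfl⟩)
      exact ⟨m, by rw [← hm, inner_dilation_left]⟩
    have hSy : S y ≠ 0 := fun h => hy0 (by rw [← hinv y, h, map_zero])
    have hlo := hlow _ hz (smul_ne_zero (Int.cast_ne_zero.mpr hD) hSy) (by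
      rw [norm_smul, Real.norm_eq_abs]
      calc |(D : ℝ)| * ‖S y‖ ≤ |(D : ℝ)| * (2 * Q * ‖y‖) := by gcongr; exact hnorm y
        _ = Q * (‖y‖ * (2 * |(D : ℝ)|)) := by ring
        _ ≤ Q * 1 := by gcongr
        _ = Q := mul_one Q)
    rw [real_inner_smul_right, inner_dilation_self ha, abs_mul, abs_mul, abs_inv,
      abs_of_pos hK] at hlo
    have : |(D : ℝ)| * (K⁻¹ * |inner ℝ a y|) < ‖a‖ / K := by
      calc |(D : ℝ)| * (K⁻¹ * |inner ℝ a y|) ≤ |(D : ℝ)| * (K⁻¹ * (‖a‖ * ‖y‖)) := by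
            gcongr
            exact abs_real_inner_le_norm a y
        _ = ‖a‖ / K * (‖y‖ * |(D : ℝ)|) := by ring
        _ < ‖a‖ / K * 1 := by
            gcongr
            have : 0 ≤ ‖y‖ * |(D : ℝ)| := by positivity
            linarith
        _ = ‖a‖ / K := mul_one _
    exact absurd hlo (not_le.mpr this)

end Dilation

/-- The difficult half of the transference principle: a lower bound for `|z ⬝ᵥ α|` over the nonzero
integer vectors of norm at most `Q` in the rational hull yields a full set of linearly independent
simultaneous approximations. -/
theorem exists_hasIndep_of_lower_bound {n : ℕ} {α : Fin n → ℝ} (hα : α ≠ 0) (j : Fin n) :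
    ∃ c A : ℝ, 1 ≤ c ∧ 0 < A ∧ ∀ Q K : ℝ, 0 < Q → 0 < K → 1 ≤ K * Q →
      (∀ z : Fin n → ℤ, toReal z ∈ rationalHull α → toReal z ≠ 0 → ‖toReal z‖ ≤ Q →
        A / K ≤ |toReal z ⬝ᵥ α|) →
      HasIndep α (numFreq α) fun x =>
        ‖toReal x‖ ≤ c * K ∧ ‖(x j : ℝ) • α - α j • toReal x‖ ≤ c / Q := by
  -- The rational hull with the Euclidean norm.
  let E : Submodule ℝ (EuclideanSpace ℝ (Fin n)) :=
    (rationalHull α).comap (WithLp.linearEquiv 2 ℝ (Fin n → ℝ)).toLinearMap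
  let p : E →ₗ[ℝ] (Fin n → ℝ) := (WithLp.linearEquiv 2 ℝ (Fin n → ℝ)).toLinearMap ∘ₗ E.subtype
  have hp : ∀ w : E, p w ∈ rationalHull α := fun w => w.2
  have hpinj : Function.Injective p :=
    (WithLp.linearEquiv 2 ℝ (Fin n → ℝ)).injective.comp Subtype.val_injective
  have hpsurj : ∀ v ∈ rationalHull α, ∃ w : E, p w = v := fun v hv => ⟨⟨WithLp.toLp 2 v, hv⟩, rfl⟩
  have hinner : ∀ v w : E, inner ℝ v w = p v ⬝ᵥ p w := fun v w => by
    rw [dotProduct_comm]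
    rfl
  have hpnorm : ∀ w : E, ‖p w‖ ≤ ‖w‖ := fun w =>
    (pi_norm_le_iff_of_nonneg (norm_nonneg _)).mpr fun i =>
      PiLp.norm_apply_le (w : EuclideanSpace ℝ (Fin n)) i
  obtain ⟨a, ha⟩ := hpsurj α (mem_rationalHull α)
  have ha0 : a ≠ 0 := fun h => hα (by rw [← ha, h, map_zero])
  let L : Submodule ℤ E :=
    { carrier := {w | ∃ x : Fin n → ℤ, p w = toReal x}
      zero_mem' := ⟨0, by ext; simp [toReal]⟩
      add_mem' := by
        rintro v w ⟨x, hx⟩ ⟨y, hy⟩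
        exact ⟨x + y, by rw [map_add, hx, hy]; ext; simp [toReal]⟩
      smul_mem' := by
        rintro m w ⟨x, hx⟩
        exact ⟨m • x, by rw [map_zsmul, hx]; ext; simp [toReal]⟩ }
  have hL : ∀ w, w ∈ L ↔ ∃ x : Fin n → ℤ, p w = toReal x := fun w => Iff.rfl
  have hfin : ∀ R : ℝ, {x | x ∈ L ∧ ‖x‖ ≤ R}.Finite := by
    intro R
    refine (((finite_toReal_norm_le R).image toReal).preimage hpinj.injOn).subset ?_
    rintro w ⟨⟨x, hx⟩, hw⟩
    exact ⟨x, by rw [Set.mem_ofPred_eq, ← hx]; exact (hpnorm w).trans hw, hx.symm⟩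
  have hspan : span ℝ (L : Set E) = ⊤ := by
    rw [eq_top_iff]
    intro w _
    have himage : p '' (L : Set E) =
        {v | v ∈ rationalHull α ∧ ∃ x : Fin n → ℤ, v = toReal x} := by
      ext v
      constructor
      · rintro ⟨w, ⟨x, hx⟩, rfl⟩
        exact ⟨hp w, x, hx⟩
      · rintro ⟨hv, x, hx⟩
        obtain ⟨w, rfl⟩ := hpsurj v hv
        exact ⟨w, ⟨x, hx⟩, rfl⟩
    have h2 := hp w
    rw [← span_toReal_eq_rationalHull, ← himage, span_image] at h2
    obtain ⟨w', hw', he⟩ := h2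
    exact hpinj he ▸ hw'
  obtain ⟨D, hD, hDdual⟩ := exists_smul_dual_integer α
  obtain ⟨C, hC, htrans⟩ := exists_span_dilation_eq_top ha0 L hfin hspan hD (by
    intro y hy
    obtain ⟨z, hz⟩ := hDdual (p y) (hp y) fun x hx => by
      obtain ⟨w, hw⟩ := hpsurj _ hx
      obtain ⟨m, hm⟩ := hy w ⟨x, hw⟩
      exact ⟨m, by rw [← hm, hinner, hw]⟩
    exact ⟨z, by rw [map_smul, hz]⟩)
  refine ⟨1 + 2 * C + 2 * ‖α‖ * C, ‖a‖, ?_, norm_pos_iff.mpr ha0, ?_⟩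
  · have : 0 ≤ 2 * C + 2 * ‖α‖ * C := by positivity
    linarith
  intro Q K hQ hK hKQ hlow
  change HasIndep α (finrank ℝ (rationalHull α)) _
  have key := htrans Q K hQ hK hKQ (by
    rintro z ⟨x, hx⟩ hz0 hzQ
    have := hlow x (hx ▸ hp z) (hx ▸ fun h => hz0 (hpinj (by rw [h, map_zero])))
      (hx ▸ (hpnorm z).trans hzQ)
    rwa [hinner, ha, hx, dotProduct_comm])
  have hspan' := congrArg (Submodule.map p) key
  rw [← span_image] at hspan'
  have hrange : Submodule.map p ⊤ = rationalHull α := by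
    ext v
    constructor
    · rintro ⟨w, -, rfl⟩
      exact hp w
    · intro hv
      obtain ⟨w, rfl⟩ := hpsurj v hv
      exact ⟨w, trivial, rfl⟩
  rw [hrange] at hspan'
  obtain ⟨f, hf, -, hli⟩ := exists_fin_linearIndependent hspan'
  choose w hw hwf using hf
  choose x hx using fun i => (hL (w i)).mp (hw i).1
  have hxf : ∀ i, toReal (x i) = f i := fun i => by rw [← hx, hwf]
  have hKinv : Q⁻¹ ≤ K := by rwa [inv_le_iff_one_le_mul₀ hQ]
  have hQinv : 0 < Q⁻¹ := by positivity
  refine ⟨x, (funext hxf : (fun i => toReal (x i)) = f) ▸ hli, fun i => ⟨hx i ▸ hp _, ?_, ?_⟩⟩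
  · obtain ⟨u, hu, hwu⟩ := (hw i).2
    rw [← hx]
    calc ‖p (w i)‖ ≤ ‖w i‖ := hpnorm _
      _ ≤ (|Q⁻¹| + |K - Q⁻¹|) * ‖u‖ := by rw [hwu]; exact norm_dilation_le ha0 _ _ _
      _ = K * ‖u‖ := by rw [abs_of_pos hQinv, abs_of_nonneg (by linarith)]; ring
      _ ≤ K * C := by gcongr
      _ ≤ (1 + 2 * C + 2 * ‖α‖ * C) * K := by
        rw [mul_comm]
        gcongr
        have : 0 ≤ ‖α‖ * C := by positivity
        linarith
  · obtain ⟨u, hu, hwu⟩ := (hw i).2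
    -- The component along `α` does not contribute to `x j • α - α j • x`.
    have hxu : toReal (x i) = Q⁻¹ • p u + ((K - Q⁻¹) / ‖a‖ ^ 2 * inner ℝ a u) • α := by
      rw [← hx, hwu, dilation_apply, map_add, map_smul, map_smul, ha]
    have hxj : (x i j : ℝ) = Q⁻¹ * p u j + (K - Q⁻¹) / ‖a‖ ^ 2 * inner ℝ a u * α j := by
      simpa [toReal] using congrFun hxu j
    have hcancel : (x i j : ℝ) • α - α j • toReal (x i) = Q⁻¹ • (p u j • α - α j • p u) := by
      rw [hxu, hxj]
      ext k
      simp only [Pi.sub_apply, Pi.smul_apply, Pi.add_apply, smul_eq_mul]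
      ring
    have h1 : ‖p u‖ ≤ C := (hpnorm u).trans hu
    have h2 : |p u j| ≤ C := (norm_le_pi_norm (p u) j).trans h1
    have h3 : |α j| ≤ ‖α‖ := norm_le_pi_norm α j
    rw [hcancel, norm_smul, Real.norm_eq_abs, abs_of_pos hQinv]
    calc Q⁻¹ * ‖p u j • α - α j • p u‖ ≤ Q⁻¹ * (C * ‖α‖ + ‖α‖ * C) := by
          gcongr
          refine (norm_sub_le _ _).trans ?_
          rw [norm_smul, norm_smul, Real.norm_eq_abs, Real.norm_eq_abs]
          gcongr
      _ ≤ Q⁻¹ * (1 + 2 * C + 2 * ‖α‖ * C) := by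
          refine mul_le_mul_of_nonneg_left ?_ hQinv.le
          linarith
      _ = (1 + 2 * C + 2 * ‖α‖ * C) / Q := by rw [div_eq_inv_mul]

/-! ### Comparison of the two approximation functions -/

/-- The easy half of the transference principle: some member of a full set of simultaneous
approximations pairs nontrivially with `y`, and a nonzero integer has absolute value at least `1`. -/
theorem le_of_mem_psiSet_of_mem_psiPrimeSet {n : ℕ} {α : Fin n → ℝ} {j : Fin n} (hα : α ≠ 0)
    (hj : |α j| = ‖α‖) {Q K K' : ℝ} (hQ : 0 < Q) (hK : K ∈ psiSet α j (numFreq α) Q)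
    (hK' : K' ∈ psiPrimeSet α 1 (‖α‖ / (2 * n) * Q)) : K' ≤ 2 / ‖α‖ * K := by
  obtain ⟨hK0, x, hxli, hx⟩ := hK
  obtain ⟨hK'0, y, hyli, hy⟩ := hK'
  obtain ⟨hyα, hyQ, hyK⟩ := hy 0
  have hy0 : toReal (y 0) ≠ 0 := hyli.ne_zero 0
  have hα0 : 0 < ‖α‖ := norm_pos_iff.mpr hα
  have hn : (0 : ℝ) < n := Nat.cast_pos.mpr (Fin.pos j)
  have hspan : span ℝ (Set.range fun p => toReal (x p)) = rationalHull α := by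
    refine eq_of_le_of_finrank_eq ?_ ?_
    · rw [span_le]
      rintro _ ⟨p, rfl⟩
      exact (hx p).1
    · rw [finrank_span_eq_card hxli, Fintype.card_fin]
      rfl
  obtain ⟨p, hp⟩ : ∃ p, toReal (x p) ⬝ᵥ toReal (y 0) ≠ 0 := by
    by_contra! h
    refine hy0 (dotProduct_self_eq_zero.mp ?_)
    rw [← hspan] at hyα
    have : ∀ w ∈ span ℝ (Set.range fun p => toReal (x p)), w ⬝ᵥ toReal (y 0) = 0 := by
      intro w hw
      induction hw using span_induction with
      | zero => exact zero_dotProduct _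
      | add x y _ _ hx hy => rw [add_dotProduct, hx, hy, add_zero]
      | smul c x _ hx => rw [smul_dotProduct, hx, smul_zero]
      | mem w hw => obtain ⟨p, rfl⟩ := hw; exact h p
    exact this _ hyα
  obtain ⟨hxα, hxK, hxQ⟩ := hx p
  have hint : toReal (x p) ⬝ᵥ toReal (y 0) = ((x p ⬝ᵥ y 0 : ℤ) : ℝ) := by
    simp [dotProduct, toReal]
  have hone : 1 ≤ |toReal (x p) ⬝ᵥ toReal (y 0)| := by
    rw [hint] at hp ⊢
    exact_mod_cast Int.one_le_abs (Int.cast_ne_zero.mp hp)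
  set e : Fin n → ℝ := (x p j : ℝ) • α - α j • toReal (x p) with he
  -- `α j (x ⬝ y) = x j (α ⬝ y) - e ⬝ y`
  have hdec : α j * (toReal (x p) ⬝ᵥ toReal (y 0)) =
      x p j * (toReal (y 0) ⬝ᵥ α) - e ⬝ᵥ toReal (y 0) := by
    rw [he, sub_dotProduct, smul_dotProduct, smul_dotProduct, dotProduct_comm α]
    simp
  have hxj : |(x p j : ℝ)| ≤ K := (norm_le_pi_norm (toReal (x p)) j).trans hxK
  have hey : |e ⬝ᵥ toReal (y 0)| ≤ ‖α‖ / 2 := by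
    calc |e ⬝ᵥ toReal (y 0)| ≤ ∑ i, |e i * toReal (y 0) i| := Finset.abs_sum_le_sum_abs _ _
      _ ≤ ∑ _i : Fin n, Q⁻¹ * (‖α‖ / (2 * n) * Q) := by
        refine Finset.sum_le_sum fun i _ => ?_
        rw [abs_mul]
        gcongr
        · exact (norm_le_pi_norm e i).trans hxQ
        · exact (norm_le_pi_norm (toReal (y 0)) i).trans hyQ
      _ = ‖α‖ / 2 := by
        rw [Finset.sum_const, Finset.card_univ, Fintype.card_fin, nsmul_eq_mul]
        field_simp
  have h1 : ‖α‖ ≤ K * K'⁻¹ + ‖α‖ / 2 := by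
    calc ‖α‖ ≤ |α j| * |toReal (x p) ⬝ᵥ toReal (y 0)| := by
          rw [hj]
          exact le_mul_of_one_le_right hα0.le hone
      _ = |x p j * (toReal (y 0) ⬝ᵥ α) - e ⬝ᵥ toReal (y 0)| := by rw [← abs_mul, hdec]
      _ ≤ |(x p j : ℝ)| * |toReal (y 0) ⬝ᵥ α| + |e ⬝ᵥ toReal (y 0)| := by
          rw [← abs_mul]
          exact abs_sub _ _
      _ ≤ K * K'⁻¹ + ‖α‖ / 2 := by gcongr
  have h2 : ‖α‖ / 2 * K' ≤ K := by
    calc ‖α‖ / 2 * K' ≤ K * K'⁻¹ * K' := by gcongr; linarith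
      _ = K := by field_simp
  calc K' = 2 / ‖α‖ * (‖α‖ / 2 * K') := by field_simp
    _ ≤ 2 / ‖α‖ * K := by gcongr

theorem hasIndep_one {n : ℕ} {α : Fin n → ℝ} {P : (Fin n → ℤ) → Prop} {x : Fin n → ℤ}
    (hx : toReal x ∈ rationalHull α) (hx0 : toReal x ≠ 0) (hP : P x) : HasIndep α 1 P :=
  ⟨fun _ => x, linearIndependent_unique_iff.mpr hx0, fun _ => ⟨hx, hP⟩⟩

theorem exists_toReal_mem_rationalHull_ne_zero {n : ℕ} {α : Fin n → ℝ} (hα : α ≠ 0) :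
    ∃ x : Fin n → ℤ, toReal x ∈ rationalHull α ∧ toReal x ≠ 0 := by
  by_contra! h
  have hα' := mem_rationalHull α
  rw [← span_toReal_eq_rationalHull] at hα'
  have hbot : span ℝ {v | v ∈ rationalHull α ∧ ∃ x : Fin n → ℤ, v = toReal x} = ⊥ := by
    refine span_eq_bot.mpr ?_
    rintro _ ⟨hv, x, rfl⟩
    exact h x hv
  exact hα ((mem_bot ℝ).mp (hbot ▸ hα'))

theorem one_le_numFreq {n : ℕ} {α : Fin n → ℝ} (hα : α ≠ 0) : 1 ≤ numFreq α := by
  have : Nontrivial (rationalHull α) :=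
    ⟨⟨⟨α, mem_rationalHull α⟩, 0, fun h => hα (congrArg Subtype.val h)⟩⟩
  exact finrank_pos

/-- By finiteness, the integer vectors of bounded norm in the rational hull stay uniformly away
from the orthogonal complement of `α`. -/
theorem exists_pos_le_abs_dotProduct {n : ℕ} (α : Fin n → ℝ) (R : ℝ) : ∃ δ : ℝ, 0 < δ ∧
    ∀ z : Fin n → ℤ, toReal z ∈ rationalHull α → toReal z ≠ 0 → ‖toReal z‖ ≤ R →
      δ ≤ |toReal z ⬝ᵥ α| := by
  set s : Set (Fin n → ℤ) := {z | ‖toReal z‖ ≤ R ∧ toReal z ∈ rationalHull α ∧ toReal z ≠ 0}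
  have hs : s.Finite := (finite_toReal_norm_le R).subset fun z hz => hz.1
  rcases s.eq_empty_or_nonempty with h | h
  · refine ⟨1, one_pos, fun z hz hz0 hzR => ?_⟩
    have : z ∈ s := ⟨hzR, hz, hz0⟩
    rw [h] at this
    exact this.elim
  · obtain ⟨w, hw, hmin⟩ := Set.exists_min_image s (fun z => |toReal z ⬝ᵥ α|) hs h
    exact ⟨_, abs_pos.mpr (dotProduct_ne_zero hw.2.1 hw.2.2),
      fun z hz hz0 hzR => hmin z ⟨hzR, hz, hz0⟩⟩

theorem bddAbove_psiPrimeSet {n : ℕ} (α : Fin n → ℝ) (Q : ℝ) : BddAbove (psiPrimeSet α 1 Q) := by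
  obtain ⟨δ, hδ, hlow⟩ := exists_pos_le_abs_dotProduct α Q
  refine ⟨δ⁻¹, ?_⟩
  rintro K ⟨hK, x, hx, hx'⟩
  obtain ⟨h1, h2, h3⟩ := hx' 0
  exact (le_inv_comm₀ hK hδ).mpr ((hlow _ h1 (hx.ne_zero 0) h2).trans h3)

/-- The lower bound for `|z ⬝ᵥ α|` given by `Ψ'_1`. -/
theorem inv_psiPrime_le_abs_dotProduct {n : ℕ} {α : Fin n → ℝ} {Q : ℝ} {z : Fin n → ℤ}
    (hz : toReal z ∈ rationalHull α) (hz0 : toReal z ≠ 0) (hzQ : ‖toReal z‖ ≤ Q) :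
    |toReal z ⬝ᵥ α|⁻¹ ≤ psiPrime α 1 Q :=
  le_csSup (bddAbove_psiPrimeSet α Q)
    ⟨inv_pos.mpr (abs_pos.mpr (dotProduct_ne_zero hz hz0)),
      hasIndep_one hz hz0 ⟨hzQ, (inv_inv _).ge⟩⟩

end Dio

open Dio in
/-- The first three clauses say that `C'_1`, `Ψ_d(Q)` for `Q ≥ 1` and `Ψ'_1(Q)` for `Q ≥ C'_1` are
well defined (the infima and the supremum are over nonempty, suitably bounded sets). -/
theorem mainTheorem5 (n : ℕ) (hn : 2 ≤ n) (α : Fin n → ℝ) (hα : α ≠ 0)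
    (j : Fin n) (hj : |α j| = ‖α‖) (τ : ℝ) (hτ : (Dio.numFreq α : ℝ) - 1 ≤ τ) :
    (∃ N : ℕ, 1 ≤ N ∧ Dio.HasIndep α 1 fun x => ‖Dio.toReal x‖ ≤ (N : ℝ)) ∧
    (∀ Q : ℝ, 1 ≤ Q → (Dio.psiSet α j (Dio.numFreq α) Q).Nonempty) ∧
    (∀ Q : ℝ, (Dio.cPrime α 1 : ℝ) ≤ Q →
      (Dio.psiPrimeSet α 1 Q).Nonempty ∧ BddAbove (Dio.psiPrimeSet α 1 Q)) ∧
    (Dio.IsDiophantine α τ ↔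
      ∃ Q₀ C : ℝ, 1 ≤ Q₀ ∧ 0 < C ∧
        ∀ Q : ℝ, Q₀ ≤ Q → Dio.psi α j (Dio.numFreq α) Q ≤ C * Q ^ τ) := by
  have hα0 : 0 < ‖α‖ := norm_pos_iff.mpr hα
  have hτ0 : 0 ≤ τ := by
    have : (1 : ℝ) ≤ numFreq α := by exact_mod_cast one_le_numFreq hα
    linarith
  have hC₁ : ∃ N : ℕ, 1 ≤ N ∧ HasIndep α 1 fun x => ‖toReal x‖ ≤ (N : ℝ) := by
    obtain ⟨x, hx, hx0⟩ := exists_toReal_mem_rationalHull_ne_zero hα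
    exact ⟨⌈‖toReal x‖⌉₊, Nat.one_le_ceil_iff.mpr (norm_pos_iff.mpr hx0),
      hasIndep_one hx hx0 (Nat.le_ceil _)⟩
  obtain ⟨c, A, hc, hA, hind⟩ := exists_hasIndep_of_lower_bound hα j
  have hc0 : 0 < c := by linarith
  have hmem : ∀ Q K : ℝ, 1 ≤ Q → 1 ≤ K →
      (∀ z : Fin n → ℤ, toReal z ∈ rationalHull α → toReal z ≠ 0 → ‖toReal z‖ ≤ c * Q →
        A / K ≤ |toReal z ⬝ᵥ α|) → c * K ∈ psiSet α j (numFreq α) Q := by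
    intro Q K hQ hK hlow
    have hcQ : 1 ≤ c * Q := one_le_mul_of_one_le_of_one_le hc hQ
    have := hind (c * Q) K (by positivity) (by positivity)
      (one_le_mul_of_one_le_of_one_le hK hcQ) hlow
    rw [div_mul_cancel_left₀ hc0.ne'] at this
    exact ⟨by positivity, this⟩
  have hpsi : ∀ Q : ℝ, 1 ≤ Q → (psiSet α j (numFreq α) Q).Nonempty := by
    intro Q hQ
    obtain ⟨δ, hδ, hlow⟩ := exists_pos_le_abs_dotProduct α (c * Q)
    refine ⟨_, hmem Q (max 1 (A / δ)) hQ (le_max_left _ _) fun z hz hz0 hzQ => ?_⟩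
    refine le_trans ?_ (hlow z hz hz0 hzQ)
    rw [div_le_comm₀ (by positivity) hδ]
    exact le_max_right _ _
  have hpsi' : ∀ Q : ℝ, (cPrime α 1 : ℝ) ≤ Q → (psiPrimeSet α 1 Q).Nonempty := by
    intro Q hQ
    obtain ⟨-, x, hx, hx'⟩ := Nat.sInf_mem hC₁
    obtain ⟨h1, h2⟩ := hx' 0
    refine ⟨(|toReal (x 0) ⬝ᵥ α| + 1)⁻¹, by positivity,
      hasIndep_one h1 (hx.ne_zero 0) ⟨h2.trans hQ, ?_⟩⟩
    rw [inv_inv]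
    linarith
  refine ⟨hC₁, hpsi, fun Q hQ => ⟨hpsi' Q hQ, bddAbove_psiPrimeSet α Q⟩, ?_, ?_⟩
  · rintro ⟨Q', C', -, hC', h⟩
    -- The maximum with `1` keeps `K ≥ 1`, as `hmem` requires; `0 ≤ τ` gives `1 ≤ Q ^ τ`.
    have hB : 0 < max 1 (A * C' * c ^ τ) := by positivity
    refine ⟨max 1 Q', c * max 1 (A * C' * c ^ τ), le_max_left _ _, by positivity, ?_⟩
    intro Q hQ
    have hQ1 : 1 ≤ Q := (le_max_left _ _).trans hQ
    have hQτ : 1 ≤ Q ^ τ := Real.one_le_rpow hQ1 hτ0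
    have hQc : Q' ≤ c * Q :=
      ((le_max_right _ _).trans hQ).trans (le_mul_of_one_le_left (by linarith) hc)
    rw [mul_assoc]
    refine csInf_le ⟨0, fun K hK => hK.1.le⟩ (hmem Q _ hQ1
      (one_le_mul_of_one_le_of_one_le (le_max_left _ _) hQτ) fun z hz hz0 hzQ => ?_)
    have hpos : 0 < |toReal z ⬝ᵥ α| := abs_pos.mpr (dotProduct_ne_zero hz hz0)
    have h1 : |toReal z ⬝ᵥ α|⁻¹ ≤ C' * (c * Q) ^ τ :=
      (inv_psiPrime_le_abs_dotProduct hz hz0 hzQ).trans (h _ hQc)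
    rw [Real.mul_rpow hc0.le (by linarith)] at h1
    rw [div_le_comm₀ (by positivity) hpos, div_eq_mul_inv]
    calc A * |toReal z ⬝ᵥ α|⁻¹ ≤ A * (C' * (c ^ τ * Q ^ τ)) := by gcongr
      _ = A * C' * c ^ τ * Q ^ τ := by ring
      _ ≤ max 1 (A * C' * c ^ τ) * Q ^ τ := by
        gcongr
        exact le_max_right _ _
  · rintro ⟨Q₀, C, hQ₀, hC, h⟩
    have hn0 : (0 : ℝ) < n := Nat.cast_pos.mpr (by omega)
    set κ : ℝ := ‖α‖ / (2 * n) with hκ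
    have hκ0 : 0 < κ := by positivity
    refine ⟨max (cPrime α 1) (κ * Q₀), 2 / ‖α‖ * (C / κ ^ τ), le_max_left _ _, by positivity, ?_⟩
    intro Q hQ
    have hQκ : Q₀ ≤ Q / κ := by
      rw [le_div_iff₀ hκ0, mul_comm]
      exact (le_max_right _ _).trans hQ
    have hQ0 : 0 < Q / κ := by linarith
    have hQeq : κ * (Q / κ) = Q := mul_div_cancel₀ Q hκ0.ne'
    refine csSup_le (hpsi' Q ((le_max_left _ _).trans hQ)) fun K' hK' => ?_
    have hle : ‖α‖ / 2 * K' ≤ psi α j (numFreq α) (Q / κ) := by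
      refine le_csInf (hpsi _ (hQ₀.trans hQκ)) fun K hK => ?_
      have := le_of_mem_psiSet_of_mem_psiPrimeSet hα hj hQ0 hK (by rwa [← hκ, hQeq])
      calc ‖α‖ / 2 * K' ≤ ‖α‖ / 2 * (2 / ‖α‖ * K) := by gcongr
        _ = K := by field_simp
    have hle2 := hle.trans (h _ hQκ)
    rw [Real.div_rpow (by rw [← hQeq]; positivity) hκ0.le] at hle2
    calc K' = 2 / ‖α‖ * (‖α‖ / 2 * K') := by field_simp
      _ ≤ 2 / ‖α‖ * (C * (Q ^ τ / κ ^ τ)) := by gcongr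
      _ = 2 / ‖α‖ * (C / κ ^ τ) * Q ^ τ := by ring
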